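/- There is an absolute constant $\kappa>0$ such that for every integer $d\ge 1$ there exist an integer $c \ge 0$, a finite action space $\mathcal U\subset\mathbb Z^{c}$, integer matrices $A\in\mathbb Z^{d\times d}$, $B\in\mathbb Z^{d\times c}$, and a finite family $\mathcal F$ of triples of cost functions $(g_{\mathrm x},g_{\mathrm u},g_T)$ with $g_{\mathrm x},g_T:\mathcal X\to\mathbb R$ and $g_{\mathrm u}:\mathcal U\to\mathbb R$, where $\mathcal X=\{0,1\}^d$, with the following properties. 1. Each triple in $\mathcal F$ defines a purely discrete deterministic dynamic programming problem with state space $\mathcal X$, action space $\mathcal U$, dynamics $(x,u)\mapsto Ax+Bu$, running cost $g_{\mathrm x}(x)+g_{\mathrm u}(u)$, terminal cost $g_T$ and horizon $T=1$, which satisfies the following assumptions. * (Modelling) $g_T$, $g_{\mathrm x}$ and $g_{\mathrm u}$ have extensions to convex functions on $\operatorname{conv}(\mathcal X)$, $\operatorname{conv}(\mathcal X)$ and $\operatorname{conv}(\mathcal U)$, respectively, which are differentiable with Lipschitz continuous gradient and strongly convex (that is, have a finite condition number); the extensions of $g_T$ and $g_{\mathrm x}$ are moreover Lipschitz continuous.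 * (Feasibility) For every $J:\mathcal X\to\mathbb R$ and every $x\in\mathcal X$, the minimum of $g_{\mathrm u}(u)+J(Ax+Bu)$ (over the $u \in \mathcal U$ with $Ax+Bu\in\mathcal X$) is attained, and the minimum over $u\in\mathcal U$ of $g_{\mathrm u}(u)+\bar J(Ax+Bu)$ is attained at some $u$ with $Ax+Bu\in\mathcal X$, where $\bar J(z)=\sup\{\langle p,z\rangle+a : \langle p,y\rangle+a\le J(y)\ \forall y\in\mathcal X\}\in(-\infty,\infty]$. 2. For every $x\in\mathcal X$, every quantum query algorithm (arbitrary unitaries, on a finite-dimensional space, interleaved with calls to an oracle that evaluates $g_{\mathrm x}$, $g_{\mathrm u}$ or $g_T$ at a point, possibly in superposition, by XORing a bit representation of the value into an answer register, followed by a measurement) which, for every triple in $\mathcal F$, outputs with probability at least $2/3$ the value $$J_0(x)=g_{\mathrm x}(x)+\min_{u\in\mathcal U,\ Ax+Bu\in\mathcal X}\{g_{\mathrm u}(u)+g_T(Ax+Bu)\}$$ makes at least $\kappa\,\sqrt{2^d}/d$ cost function evaluations (oracle calls). The algorithm may depend on $d,x,\mathcal U,A,B,\mathcal F$, but accesses the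 triple only through the oracle. -/

import Mathlib

noncomputable section

/-! ### Convex extensions of functions on finite sets of integer vectors -/

/-- An integer vector viewed as a point of Euclidean space. -/
def realPoint {n : ℕ} (x : Fin n → ℤ) : EuclideanSpace ℝ (Fin n) :=
  WithLp.toLp 2 (fun i => (x i : ℝ))

/-- The convex hull `conv(X)` of a finite set of integer vectors. -/
def realHull {n : ℕ} (X : Finset (Fin n → ℤ)) : Set (EuclideanSpace ℝ (Fin n)) :=
  convexHull ℝ (realPoint '' (X : Set (Fin n → ℤ)))

/-- `φ` is a convex function on `conv(X)` that agrees with `f` on `X`. -/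
def IsConvexExtension {n : ℕ} (X : Finset (Fin n → ℤ)) (f : X → ℝ)
    (φ : EuclideanSpace ℝ (Fin n) → ℝ) : Prop :=
  ConvexOn ℝ (realHull X) φ ∧ ∀ x : X, φ (realPoint x.1) = f x

/-- `φ` is differentiable on `K`, its gradient is `L'`-Lipschitz on `K`, and `φ` is
`μ`-strongly convex on `K` with `μ > 0`; that is, the condition number `L' / μ` is finite. -/
def HasFiniteConditionNumber {n : ℕ} (K : Set (EuclideanSpace ℝ (Fin n)))
    (φ : EuclideanSpace ℝ (Fin n) → ℝ) : Prop :=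
  ∃ (G : EuclideanSpace ℝ (Fin n) → EuclideanSpace ℝ (Fin n)) (L' : NNReal) (μ : ℝ),
    0 < μ ∧ (∀ x ∈ K, HasGradientWithinAt φ (G x) K x) ∧
      LipschitzOnWith L' G K ∧ StrongConvexOn K μ φ

/-- The largest convex extension: the pointwise supremum of all affine minorants on `X`
(it is `⊤` outside the convex hull of `X`). -/
def convexEnvelope {n : ℕ} (X : Finset (Fin n → ℤ)) (f : X → ℝ)
    (x : EuclideanSpace ℝ (Fin n)) : EReal :=
  ⨆ (p : EuclideanSpace ℝ (Fin n)) (a : ℝ)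
    (_ : ∀ y : X, inner ℝ p (realPoint y.1) + a ≤ f y), ((inner ℝ p x + a : ℝ) : EReal)

/-! ### Purely discrete deterministic dynamic programs -/

/-- The data of a purely discrete deterministic dynamic program apart from its costs: the finite
state space in `ℤ^d`, the finite action space in `ℤ^c`, the integer matrices of the linear dynamics
`(x, u) ↦ A x + B u`, and the time horizon. -/
structure DPSystem (d c : ℕ) where
  states : Finset (Fin d → ℤ)
  actions : Finset (Fin c → ℤ)
  A : Matrix (Fin d) (Fin d) ℤ
  B : Matrix (Fin d) (Fin c) ℤ
  horizon : ℕ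

/-- Separable costs: the running cost is `gx x + gu u`, the terminal cost is `gT x`. -/
structure DPCosts {d c : ℕ} (S : DPSystem d c) where
  gx : S.states → ℝ
  gu : S.actions → ℝ
  gT : S.states → ℝ

namespace DPSystem

variable {d c : ℕ} (S : DPSystem d c)

/-- The linear dynamics. -/
def next (x : Fin d → ℤ) (u : Fin c → ℤ) : Fin d → ℤ :=
  S.A.mulVec x + S.B.mulVec u

end DPSystem

namespace DPCosts

variable {d c : ℕ} {S : DPSystem d c} (C : DPCosts S)

/-- The dynamic programming operator
`DP[J](x) = min_u { gx x + gu u + J (A x + B u) }`, where `u` ranges over the actions whose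
successor state lies in the state space, so that `J` is defined there. -/
def dpOperator (J : S.states → ℝ) (x : S.states) : ℝ :=
  sInf {r : ℝ | ∃ (u : S.actions) (h : S.next x.1 u.1 ∈ S.states),
    r = C.gx x + C.gu u + J ⟨S.next x.1 u.1, h⟩}

/-- The initial value function `J₀ = DP^T[g_T]`. -/
def valueFunction : S.states → ℝ :=
  (C.dpOperator)^[S.horizon] C.gT

/-- The modelling assumptions on the costs (linearity of the dynamics and separability of the costs
are built into the data): all costs are convex extensible, the extensions of the terminal cost and
of the state cost are Lipschitz continuous, and all extensions are differentiable with finite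
condition number. -/
structure Modelling : Prop where
  terminal : ∃ φ, IsConvexExtension S.states C.gT φ ∧
    (∃ L : NNReal, LipschitzOnWith L φ (realHull S.states)) ∧
    HasFiniteConditionNumber (realHull S.states) φ
  state : ∃ φ, IsConvexExtension S.states C.gx φ ∧
    (∃ L : NNReal, LipschitzOnWith L φ (realHull S.states)) ∧
    HasFiniteConditionNumber (realHull S.states) φ
  action : ∃ φ, IsConvexExtension S.actions C.gu φ ∧
    HasFiniteConditionNumber (realHull S.actions) φ

/-- The feasibility assumptions: for every function `J` on the state space and every state `x`,
the minimum of `gu u + J (A x + B u)` is attained at an action that leads back into the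
state space; the same with `J` replaced by its convex extension. -/
structure Feasible : Prop where
  original : ∀ (J : S.states → ℝ) (x : S.states),
    ∃ (u : S.actions) (h : S.next x.1 u.1 ∈ S.states),
      ∀ (v : S.actions) (hv : S.next x.1 v.1 ∈ S.states),
        C.gu u + J ⟨S.next x.1 u.1, h⟩ ≤ C.gu v + J ⟨S.next x.1 v.1, hv⟩
  conjugate : ∀ (J : S.states → ℝ) (x : S.states),
    ∃ u : S.actions, S.next x.1 u.1 ∈ S.states ∧ ∀ v : S.actions,
      (C.gu u : EReal) + convexEnvelope S.states J (realPoint (S.next x.1 u.1)) ≤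
        (C.gu v : EReal) + convexEnvelope S.states J (realPoint (S.next x.1 v.1))

/-- The possible arguments of a cost evaluation: a state for `gx`, an action for `gu`, or a state
for `gT`. -/
abbrev Query {d c : ℕ} (S : DPSystem d c) : Type :=
  S.states ⊕ (S.actions ⊕ S.states)

/-- One evaluation of one of the three cost functions. -/
def eval : Query S → ℝ :=
  Sum.elim C.gx (Sum.elim C.gu C.gT)

end DPCosts

/-! ### Quantum query algorithms -/

/-- A quantum algorithm with oracle access to a real function on the finite set `Q`. Its Hilbert
space has the computational basis `|q, y, z⟩`, with `q` the query register, `y` a `b`-bit answer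
register and `z` a workspace of arbitrary finite dimension `w`. The algorithm starts in the basis
state `init`, applies `U 0, O, U 1, O, …, O, U numQueries`, where the `U k` are arbitrary unitaries
and `O` is the oracle, measures in the computational basis, and outputs the number that `output`
assigns to the outcome. The algorithm chooses how function values are represented by
`b` bits (`encode`); no restriction is made on this choice. -/
structure QuantumAlgorithm (Q : Type) [Fintype Q] [DecidableEq Q] where
  b : ℕ
  w : ℕ
  encode : ℝ → (Fin b → ZMod 2)
  numQueries : ℕ
  U : ℕ → Matrix.unitaryGroup (Q × (Fin b → ZMod 2) × Fin w) ℂ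
  init : Q × (Fin b → ZMod 2) × Fin w
  output : Q × (Fin b → ZMod 2) × Fin w → ℝ

namespace QuantumAlgorithm

variable {Q : Type} [Fintype Q] [DecidableEq Q] (M : QuantumAlgorithm Q)

/-- The computational basis. -/
abbrev Basis : Type := Q × (Fin M.b → ZMod 2) × Fin M.w

/-- The oracle `|q, y, z⟩ ↦ |q, y ⊕ encode (f q), z⟩`, acting on amplitudes. -/
def oracle (f : Q → ℝ) (ψ : M.Basis → ℂ) : M.Basis → ℂ :=
  fun i => ψ (i.1, i.2.1 + M.encode (f i.1), i.2.2)

/-- The state right after `U k` has been applied, that is, after `k` oracle calls. -/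
def stateAfter (f : Q → ℝ) : ℕ → (M.Basis → ℂ)
  | 0 => (M.U 0 : Matrix M.Basis M.Basis ℂ).mulVec (Pi.single M.init 1)
  | k + 1 => (M.U (k + 1) : Matrix M.Basis M.Basis ℂ).mulVec (M.oracle f (stateAfter f k))

/-- The probability that the algorithm with oracle `f` outputs `r`. -/
def outputProb (f : Q → ℝ) (r : ℝ) : ℝ :=
  ∑ i : M.Basis with M.output i = r, ‖M.stateAfter f M.numQueries i‖ ^ 2

end QuantumAlgorithm

end

/-! Unstructured search is hidden in the terminal cost. With actions in `{-1, 0, 1}^d` and dynamics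
`x + u`, every vertex of the cube reaches every other in one step, at action cost at most `d`. The
family consists of the terminal cost `0` and, for each vertex `w`, the cost `-(d + 1)` at `w` and
`0` elsewhere. For the zero cost it is optimal to stay put; a marked vertex makes the value strictly
smaller (`hypercubeCosts_valueFunction_single_lt`). An algorithm that computes the value therefore
separates the zero oracle from `2 ^ d` oracles that each differ from it at one point, and the hybrid
argument (`sqrt_card_le_numQueries`) forces at least `√(2 ^ d) / 10` queries.

The assumptions do not exclude such costs. Each vertex can be cut off from the others by a
hyperplane, so subtracting a one-sided quadratic lowers that vertex alone; a large multiple of `‖z‖²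
- ∑ z i`, which vanishes at all vertices, restores strong convexity
(`exists_dentedQuadratic_eq_single`). Integer points off the cube lie outside its hull, so the
envelope excludes infeasible actions (`convexEnvelope_hypercube_eq_top`). -/

/-! ### The hybrid argument for quantum query algorithms -/

/-- The Euclidean norm of a vector of amplitudes. -/
noncomputable def amplitudeNorm {ι : Type*} [Fintype ι] (ψ : ι → ℂ) : ℝ :=
  ‖(WithLp.toLp 2 ψ : EuclideanSpace ℂ ι)‖

section AmplitudeNorm

variable {ι : Type*} [Fintype ι]

theorem amplitudeNorm_nonneg (ψ : ι → ℂ) : 0 ≤ amplitudeNorm ψ := norm_nonneg _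

theorem amplitudeNorm_sq (ψ : ι → ℂ) : amplitudeNorm ψ ^ 2 = ∑ i, ‖ψ i‖ ^ 2 := by
  simp [amplitudeNorm, EuclideanSpace.norm_sq_eq]

theorem amplitudeNorm_zero : amplitudeNorm (0 : ι → ℂ) = 0 := by
  simp [amplitudeNorm]

theorem amplitudeNorm_add_le (ψ φ : ι → ℂ) :
    amplitudeNorm (ψ + φ) ≤ amplitudeNorm ψ + amplitudeNorm φ := by
  simpa [amplitudeNorm] using
    norm_add_le (WithLp.toLp 2 ψ : EuclideanSpace ℂ ι) (WithLp.toLp 2 φ)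

theorem amplitudeNorm_sub_le (ψ φ : ι → ℂ) :
    amplitudeNorm (ψ - φ) ≤ amplitudeNorm ψ + amplitudeNorm φ := by
  simpa [amplitudeNorm] using
    norm_sub_le (WithLp.toLp 2 ψ : EuclideanSpace ℂ ι) (WithLp.toLp 2 φ)

theorem amplitudeNorm_single [DecidableEq ι] (i : ι) :
    amplitudeNorm (Pi.single i (1 : ℂ)) = 1 := by
  have h : amplitudeNorm (Pi.single i (1 : ℂ)) ^ 2 = 1 := by
    rw [amplitudeNorm_sq, Finset.sum_eq_single i] <;> simp +contextual
  exact (pow_eq_one_iff_of_nonneg (amplitudeNorm_nonneg _) two_ne_zero).1 h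

theorem amplitudeNorm_comp_equiv (e : ι ≃ ι) (ψ : ι → ℂ) :
    amplitudeNorm (fun i => ψ (e i)) = amplitudeNorm ψ := by
  rw [← sq_eq_sq₀ (amplitudeNorm_nonneg _) (amplitudeNorm_nonneg _), amplitudeNorm_sq,
    amplitudeNorm_sq]
  exact e.sum_comp fun i => ‖ψ i‖ ^ 2

theorem amplitudeNorm_indicator_sq (p : ι → Prop) [DecidablePred p] (ψ : ι → ℂ) :
    amplitudeNorm ({i | p i}.indicator ψ) ^ 2 = ∑ i with p i, ‖ψ i‖ ^ 2 := by
  rw [amplitudeNorm_sq, Finset.sum_filter]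
  refine Finset.sum_congr rfl fun i _ => ?_
  by_cases h : p i <;> simp [Set.indicator, h]

theorem amplitudeNorm_indicator_le (s : Set ι) (ψ : ι → ℂ) :
    amplitudeNorm (s.indicator ψ) ≤ amplitudeNorm ψ := by
  rw [← sq_le_sq₀ (amplitudeNorm_nonneg _) (amplitudeNorm_nonneg _), amplitudeNorm_sq,
    amplitudeNorm_sq]
  exact Finset.sum_le_sum fun i _ => by gcongr; exact norm_indicator_le_norm_self _ _

theorem amplitudeNorm_unitary_mulVec [DecidableEq ι] (U : Matrix.unitaryGroup ι ℂ) (ψ : ι → ℂ) :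
    amplitudeNorm ((U : Matrix ι ι ℂ).mulVec ψ) = amplitudeNorm ψ := by
  have key : ∀ φ : ι → ℂ, ((amplitudeNorm φ ^ 2 : ℝ) : ℂ) = star φ ⬝ᵥ φ := fun φ => by
    rw [amplitudeNorm_sq, dotProduct]
    push_cast
    exact Finset.sum_congr rfl fun i _ => by
      rw [Pi.star_apply, RCLike.star_def, Complex.conj_mul']
  rw [← sq_eq_sq₀ (amplitudeNorm_nonneg _) (amplitudeNorm_nonneg _)]
  apply Complex.ofReal_injective
  rw [key, key, Matrix.star_mulVec, ← Matrix.dotProduct_mulVec, Matrix.mulVec_mulVec,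
    ← Matrix.star_eq_conjTranspose, Matrix.UnitaryGroup.star_mul_self, Matrix.one_mulVec]

end AmplitudeNorm

namespace QuantumAlgorithm

variable {Q : Type} [Fintype Q] [DecidableEq Q] (M : QuantumAlgorithm Q)

theorem amplitudeNorm_oracle (f : Q → ℝ) (ψ : M.Basis → ℂ) :
    amplitudeNorm (M.oracle f ψ) = amplitudeNorm ψ := by
  let e : M.Basis ≃ M.Basis :=
    { toFun := fun i => (i.1, i.2.1 + M.encode (f i.1), i.2.2)
      invFun := fun i => (i.1, i.2.1 - M.encode (f i.1), i.2.2)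
      left_inv := fun i => by simp
      right_inv := fun i => by simp }
  exact amplitudeNorm_comp_equiv e ψ

theorem amplitudeNorm_stateAfter (f : Q → ℝ) (k : ℕ) :
    amplitudeNorm (M.stateAfter f k) = 1 := by
  induction k with
  | zero => rw [stateAfter, amplitudeNorm_unitary_mulVec, amplitudeNorm_single]
  | succ k ih => rw [stateAfter, amplitudeNorm_unitary_mulVec, amplitudeNorm_oracle, ih]

/-- The norm of the part of the state that queries `q` in oracle call number `k + 1`. -/
noncomputable def queryWeight (f : Q → ℝ) (q : Q) (k : ℕ) : ℝ :=
  amplitudeNorm ({i : M.Basis | i.1 = q}.indicator (M.stateAfter f k))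

/-- The two oracles agree on the part of `ψ` that does not query `q`, so that part cancels; on the
rest each oracle is an isometry, whence the factor 2. -/
theorem amplitudeNorm_oracle_sub_oracle_le {f g : Q → ℝ} {q : Q} (h : ∀ r, r ≠ q → f r = g r)
    (ψ : M.Basis → ℂ) :
    amplitudeNorm (M.oracle f ψ - M.oracle g ψ) ≤
      2 * amplitudeNorm ({i : M.Basis | i.1 = q}.indicator ψ) := by
  have hrw : M.oracle f ψ - M.oracle g ψ =
      M.oracle f ({i : M.Basis | i.1 = q}.indicator ψ) -
        M.oracle g ({i : M.Basis | i.1 = q}.indicator ψ) := by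
    funext i
    by_cases hi : i.1 = q
    · simp [oracle, Set.indicator, hi]
    · simp [oracle, Set.indicator, hi, h i.1 hi]
  rw [hrw]
  refine (amplitudeNorm_sub_le _ _).trans ?_
  rw [amplitudeNorm_oracle, amplitudeNorm_oracle, two_mul]

/-- Errors of successive calls add up because unitaries and oracles preserve norms. All weights are
taken along the run with `f`, so one run serves every `g` at once. -/
theorem amplitudeNorm_stateAfter_sub_le {f g : Q → ℝ} {q : Q} (h : ∀ r, r ≠ q → f r = g r)
    (k : ℕ) :
    amplitudeNorm (M.stateAfter f k - M.stateAfter g k) ≤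
      2 * ∑ t ∈ Finset.range k, M.queryWeight f q t := by
  induction k with
  | zero => simp [stateAfter, amplitudeNorm_zero]
  | succ k ih =>
    rw [stateAfter, stateAfter, ← Matrix.mulVec_sub, amplitudeNorm_unitary_mulVec]
    have hsplit : M.oracle f (M.stateAfter f k) - M.oracle g (M.stateAfter g k) =
        (M.oracle f (M.stateAfter f k) - M.oracle g (M.stateAfter f k)) +
          M.oracle g (M.stateAfter f k - M.stateAfter g k) := by
      funext i
      simp [oracle]
    have hle := amplitudeNorm_add_le (M.oracle f (M.stateAfter f k) - M.oracle g (M.stateAfter f k))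
      (M.oracle g (M.stateAfter f k - M.stateAfter g k))
    have hq := M.amplitudeNorm_oracle_sub_oracle_le h (M.stateAfter f k)
    rw [amplitudeNorm_oracle] at hle
    rw [hsplit, Finset.sum_range_succ, mul_add, queryWeight]
    linarith

/-- Parts of a unit vector with different query registers are orthogonal. -/
theorem sum_queryWeight_sq_le {ι : Type*} [Fintype ι] {q : ι → Q} (hq : Function.Injective q)
    (f : Q → ℝ) (k : ℕ) : ∑ j, M.queryWeight f (q j) k ^ 2 ≤ 1 := by
  have hsum : ∑ r, M.queryWeight f r k ^ 2 = 1 := by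
    simp_rw [queryWeight, amplitudeNorm_indicator_sq]
    rw [Finset.sum_fiberwise, ← amplitudeNorm_sq, amplitudeNorm_stateAfter, one_pow]
  rw [← hsum, ← Finset.sum_image (f := fun r => M.queryWeight f r k ^ 2) hq.injOn]
  exact Finset.sum_le_univ_sum_of_nonneg fun r => sq_nonneg _

theorem sum_queryWeight_le {ι : Type*} [Fintype ι] {q : ι → Q} (hq : Function.Injective q)
    (f : Q → ℝ) (k : ℕ) : ∑ j, M.queryWeight f (q j) k ≤ √(Fintype.card ι) := by
  refine Real.le_sqrt_of_sq_le ?_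
  calc (∑ j, M.queryWeight f (q j) k) ^ 2
      ≤ (Fintype.card ι : ℝ) * ∑ j, M.queryWeight f (q j) k ^ 2 := by
        simpa using sq_sum_le_card_mul_sum_sq (s := (Finset.univ : Finset ι))
          (f := fun j => M.queryWeight f (q j) k)
    _ ≤ Fintype.card ι * 1 := by
        gcongr
        exact M.sum_queryWeight_sq_le hq f k
    _ = Fintype.card ι := mul_one _

theorem outputProb_eq (f : Q → ℝ) (r : ℝ) :
    M.outputProb f r =
      amplitudeNorm ({i | M.output i = r}.indicator (M.stateAfter f M.numQueries)) ^ 2 :=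
  (amplitudeNorm_indicator_sq (fun i => M.output i = r) _).symm

theorem outputProb_add_le {r s : ℝ} (hrs : r ≠ s) (f : Q → ℝ) :
    M.outputProb f r + M.outputProb f s ≤ 1 := by
  rw [outputProb, outputProb, ← Finset.sum_union]
  · rw [← one_pow 2, ← M.amplitudeNorm_stateAfter f M.numQueries, amplitudeNorm_sq]
    exact Finset.sum_le_univ_sum_of_nonneg fun i => sq_nonneg _
  · rw [Finset.disjoint_filter]
    intro i _ h h'
    exact hrs (h.symm.trans h')

/-- Oracles on which an algorithm returns different values lead to distant final states. -/
theorem one_fifth_le_amplitudeNorm_sub {f g : Q → ℝ} {r s : ℝ} (hrs : r ≠ s)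
    (hf : 2 / 3 ≤ M.outputProb f r) (hg : 2 / 3 ≤ M.outputProb g s) :
    1 / 5 ≤ amplitudeNorm (M.stateAfter f M.numQueries - M.stateAfter g M.numQueries) := by
  have hg' : M.outputProb g r ≤ 1 / 3 := by linarith [M.outputProb_add_le hrs g]
  set P : Set M.Basis := {i | M.output i = r}
  set ψ := M.stateAfter f M.numQueries
  set φ := M.stateAfter g M.numQueries
  -- The constants satisfy `(4/5)² ≤ 2/3` and `1/3 ≤ (3/5)²`; their difference is the gap `1/5`.
  have h1 : 4 / 5 ≤ amplitudeNorm (P.indicator ψ) := by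
    refine le_of_sq_le_sq ?_ (amplitudeNorm_nonneg _)
    rw [← outputProb_eq]
    exact le_trans (by norm_num) hf
  have h2 : amplitudeNorm (P.indicator φ) ≤ 3 / 5 := by
    refine le_of_sq_le_sq ?_ (by norm_num)
    rw [← outputProb_eq]
    exact hg'.trans (by norm_num)
  have h3 : amplitudeNorm (P.indicator ψ) ≤
      amplitudeNorm (ψ - φ) + amplitudeNorm (P.indicator φ) := by
    have hrw : P.indicator ψ = P.indicator (ψ - φ) + P.indicator φ := by
      rw [← Set.indicator_add', sub_add_cancel]
    rw [hrw]
    exact (amplitudeNorm_add_le _ _).trans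
      (add_le_add_left (amplitudeNorm_indicator_le _ _) _)
  linarith

/-- The lower bound for unstructured search: an algorithm that distinguishes `f` from functions
`g j`, each of which differs from `f` in a single point `q j`, makes order of `√N` queries, where
`N` is the number of functions `g j`. -/
theorem sqrt_card_le_numQueries {ι : Type*} [Fintype ι] [Nonempty ι] {q : ι → Q}
    (hq : Function.Injective q) {f : Q → ℝ} {g : ι → Q → ℝ}
    (hfg : ∀ j r, r ≠ q j → f r = g j r) {r : ℝ} {s : ι → ℝ} (hrs : ∀ j, r ≠ s j)
    (hf : 2 / 3 ≤ M.outputProb f r) (hg : ∀ j, 2 / 3 ≤ M.outputProb (g j) (s j)) :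
    1 / 10 * √(Fintype.card ι) ≤ M.numQueries := by
  set n : ℝ := (Fintype.card ι : ℝ)
  have hn : 0 < √n := Real.sqrt_pos.2 (Nat.cast_pos.2 Fintype.card_pos)
  -- Double counting: each `j` needs total query weight at least `1/10`, while one call supplies at
  -- most `√n` over all `j`.
  have hsum : n * (1 / 5) ≤ 2 * (M.numQueries * √n) := by
    calc n * (1 / 5) = ∑ _j : ι, (1 / 5 : ℝ) := by simp [n]
      _ ≤ ∑ j, 2 * ∑ t ∈ Finset.range M.numQueries, M.queryWeight f (q j) t :=
        Finset.sum_le_sum fun j _ =>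
          (M.one_fifth_le_amplitudeNorm_sub (hrs j) hf (hg j)).trans
            (M.amplitudeNorm_stateAfter_sub_le (hfg j) _)
      _ = 2 * ∑ t ∈ Finset.range M.numQueries, ∑ j, M.queryWeight f (q j) t := by
        rw [← Finset.mul_sum, Finset.sum_comm]
      _ ≤ 2 * ∑ _t ∈ Finset.range M.numQueries, √n := by
        gcongr with t
        exact M.sum_queryWeight_le hq f t
      _ = 2 * (M.numQueries * √n) := by simp
  have hsq : √n * √n = n := Real.mul_self_sqrt (by positivity)
  refine le_of_mul_le_mul_right ?_ hn
  nlinarith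

end QuantumAlgorithm

/-! ### Smooth strongly convex functions with a one-sided quadratic dent -/

/-- The first-order remainder is at most `(t - s)²` in absolute value, also across the kink. -/
theorem hasDerivAt_max_zero_sq (s : ℝ) :
    HasDerivAt (fun t : ℝ => max 0 t ^ 2) (2 * max 0 s) s := by
  rw [hasDerivAt_iff_isLittleO]
  refine Asymptotics.IsBigO.trans_isLittleO (g := fun t => (t - s) ^ 2)
    (Asymptotics.IsBigO.of_bound 1 (Filter.Eventually.of_forall fun t => ?_)) ?_
  · rw [one_mul, Real.norm_of_nonneg (sq_nonneg (t - s)), Real.norm_eq_abs, smul_eq_mul, abs_le]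
    rcases max_cases 0 t with ⟨h, h'⟩ | ⟨h, h'⟩ <;> rcases max_cases 0 s with ⟨k, k'⟩ | ⟨k, k'⟩ <;>
      rw [h, k] <;> constructor <;> nlinarith
  · simpa using Asymptotics.isLittleO_pow_sub_sub s one_lt_two

/-- The difference `s² - max 0 s ^ 2 = max 0 (-s) ^ 2` is convex, so the squared positive part is no
more convex than `s²`. This limits what is lost by subtracting it. -/
theorem max_zero_sq_combo_le {s t α β : ℝ} (hα : 0 ≤ α) (hβ : 0 ≤ β) (h : α + β = 1) :
    α * max 0 s ^ 2 + β * max 0 t ^ 2 - α * β * (s - t) ^ 2 ≤ max 0 (α * s + β * t) ^ 2 := by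
  have hconv : ConvexOn ℝ Set.univ (fun s : ℝ => max 0 (-s) ^ 2) :=
    ((convexOn_const 0 convex_univ).sup (concaveOn_id convex_univ).neg).pow
      (fun s _ => le_max_left _ _) 2
  have key := hconv.2 (Set.mem_univ s) (Set.mem_univ t) hα hβ h
  have hsq : ∀ s : ℝ, max 0 s ^ 2 = s ^ 2 - max 0 (-s) ^ 2 := fun s => by
    rcases le_total 0 s with hs | hs <;> simp [hs]
  simp only [smul_eq_mul] at key
  rw [hsq s, hsq t, hsq (α * s + β * t)]
  obtain rfl : β = 1 - α := by linarith
  nlinarith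

section Dented

variable {E : Type*} [NormedAddCommGroup E] [InnerProductSpace ℝ E]

/-- A quadratic function minus `a` times the square of the positive part of `t - ⟪p, z⟫`. -/
noncomputable def dentedQuadratic (k a t : ℝ) (r p z : E) : ℝ :=
  k * ‖z‖ ^ 2 + inner ℝ r z - a * max 0 (t - inner ℝ p z) ^ 2

/-- The gradient of `dentedQuadratic`. -/
noncomputable def dentedQuadraticGradient (k a t : ℝ) (r p z : E) : E :=
  (2 * k) • z + r + (2 * a * max 0 (t - inner ℝ p z)) • p

theorem hasGradientAt_dentedQuadratic [CompleteSpace E] (k a t : ℝ) (r p z : E) :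
    HasGradientAt (dentedQuadratic k a t r p) (dentedQuadraticGradient k a t r p z) z := by
  have hp : HasFDerivAt (fun z : E => t - inner ℝ p z) (-(innerSL ℝ p)) z :=
    ((innerSL ℝ p).hasFDerivAt).const_sub t
  have hmax := (hasDerivAt_max_zero_sq (t - inner ℝ p z)).comp_hasFDerivAt z hp
  have hn : HasFDerivAt (fun z : E => ‖z‖ ^ 2) (2 • innerSL ℝ z) z :=
    (hasStrictFDerivAt_norm_sq z).hasFDerivAt
  have h := ((hn.const_mul k).add (innerSL ℝ r).hasFDerivAt).sub (hmax.const_mul a)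
  rw [hasGradientAt_iff_hasFDerivAt]
  refine h.congr_fderiv ?_
  ext v
  simp [dentedQuadraticGradient]
  ring

theorem lipschitzWith_dentedQuadraticGradient (k a t : ℝ) (r p : E) :
    LipschitzWith (Real.toNNReal (2 * |k| + 2 * |a| * ‖p‖ ^ 2))
      (dentedQuadraticGradient k a t r p) := by
  refine LipschitzWith.of_dist_le_mul fun x y => ?_
  rw [Real.coe_toNNReal _ (by positivity), dist_eq_norm, dist_eq_norm]
  have hmax : |max 0 (t - inner ℝ p x) - max 0 (t - inner ℝ p y)| ≤ ‖p‖ * ‖x - y‖ := by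
    have h := abs_max_sub_max_le_abs (t - inner ℝ p x) (t - inner ℝ p y) 0
    rw [max_comm _ 0, max_comm _ 0] at h
    refine h.trans ?_
    rw [sub_sub_sub_cancel_left, ← inner_sub_right, norm_sub_rev x y]
    exact abs_real_inner_le_norm _ _
  have hrw : dentedQuadraticGradient k a t r p x - dentedQuadraticGradient k a t r p y =
      (2 * k) • (x - y) +
        (2 * a * (max 0 (t - inner ℝ p x) - max 0 (t - inner ℝ p y))) • p := by
    simp only [dentedQuadraticGradient]
    module
  rw [hrw]
  refine (norm_add_le _ _).trans ?_
  rw [norm_smul, norm_smul, Real.norm_eq_abs, Real.norm_eq_abs, abs_mul, abs_mul, abs_mul, abs_two]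
  calc _ ≤ 2 * |k| * ‖x - y‖ + 2 * |a| * (‖p‖ * ‖x - y‖) * ‖p‖ := by gcongr
    _ = _ := by ring

/-- By `max_zero_sq_combo_le` and Cauchy–Schwarz, the dent lowers the coefficient `k` of `‖z‖²` by
at most `a * ‖p‖ ^ 2`. -/
theorem strongConvexOn_dentedQuadratic {K : Set E} (hK : Convex ℝ K) {k a : ℝ} (ha : 0 ≤ a) (t : ℝ)
    (r p : E) :
    StrongConvexOn K (2 * (k - a * ‖p‖ ^ 2)) (dentedQuadratic k a t r p) := by
  refine ⟨hK, fun x _ y _ α β hα hβ h => ?_⟩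
  have hm := max_zero_sq_combo_le (s := t - inner ℝ p x) (t := t - inner ℝ p y) hα hβ h
  have hcs : (inner ℝ p x - inner ℝ p y) ^ 2 ≤ ‖p‖ ^ 2 * ‖x - y‖ ^ 2 := by
    rw [← inner_sub_right, ← mul_pow]
    exact sq_le_sq' (by linarith [(abs_le.1 (abs_real_inner_le_norm p (x - y))).1])
      (real_inner_le_norm _ _)
  have hnorm : ‖α • x + β • y‖ ^ 2 = α * ‖x‖ ^ 2 + β * ‖y‖ ^ 2 - α * β * ‖x - y‖ ^ 2 := by
    rw [norm_add_sq_real, norm_sub_sq_real, norm_smul, norm_smul, inner_smul_left,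
      inner_smul_right, mul_pow, mul_pow, Real.norm_eq_abs, Real.norm_eq_abs, sq_abs, sq_abs]
    obtain rfl : β = 1 - α := by linarith
    simp only [conj_trivial]
    ring
  have harg : t - inner ℝ p (α • x + β • y) =
      α * (t - inner ℝ p x) + β * (t - inner ℝ p y) := by
    rw [inner_add_right, inner_smul_right, inner_smul_right]
    linear_combination (-t) * h
  have hαβ : 0 ≤ a * (α * β) := by positivity
  have h1 := mul_le_mul_of_nonneg_left hm ha
  have h2 := mul_le_mul_of_nonneg_left hcs hαβ
  simp only [dentedQuadratic, smul_eq_mul, hnorm, harg]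
  rw [inner_add_right, inner_smul_right, inner_smul_right]
  nlinarith

/-- A Lipschitz gradient is bounded on a bounded set, and the mean value inequality applies on
convex `K`. -/
theorem exists_lipschitzOnWith_dentedQuadratic [CompleteSpace E] {K : Set E} (hK : Convex ℝ K)
    (hb : Bornology.IsBounded K) (k a t : ℝ) (r p : E) :
    ∃ L : NNReal, LipschitzOnWith L (dentedQuadratic k a t r p) K := by
  obtain ⟨C, hC⟩ := ((lipschitzWith_dentedQuadraticGradient k a t r p).isBounded_image
    hb).exists_norm_le
  refine ⟨C.toNNReal, hK.lipschitzOnWith_of_nnnorm_hasFDerivWithin_le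
    (fun x _ => (hasGradientAt_dentedQuadratic k a t r p x).hasFDerivAt.hasFDerivWithinAt)
    fun x hx => ?_⟩
  rw [LinearIsometryEquiv.nnnorm_map, ← NNReal.coe_le_coe, coe_nnnorm]
  exact (hC _ (Set.mem_image_of_mem _ hx)).trans (Real.le_coe_toNNReal C)

end Dented

theorem hasFiniteConditionNumber_dentedQuadratic {n : ℕ} {K : Set (EuclideanSpace ℝ (Fin n))}
    (hK : Convex ℝ K) {k a : ℝ} (ha : 0 ≤ a) (t : ℝ) (r p : EuclideanSpace ℝ (Fin n))
    (hk : a * ‖p‖ ^ 2 < k) :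
    HasFiniteConditionNumber K (dentedQuadratic k a t r p) :=
  ⟨dentedQuadraticGradient k a t r p, _, 2 * (k - a * ‖p‖ ^ 2), by linarith,
    fun x _ => (hasGradientAt_dentedQuadratic k a t r p x).hasFDerivAt.hasFDerivWithinAt,
    (lipschitzWith_dentedQuadraticGradient k a t r p).lipschitzOnWith,
    strongConvexOn_dentedQuadratic hK ha t r p⟩

theorem isBounded_realHull {n : ℕ} (X : Finset (Fin n → ℤ)) :
    Bornology.IsBounded (realHull X) :=
  isBounded_convexHull.2 (X.finite_toSet.image _).isBounded

theorem convex_realHull {n : ℕ} (X : Finset (Fin n → ℤ)) : Convex ℝ (realHull X) :=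
  convex_convexHull ℝ _

theorem isConvexExtension_dentedQuadratic {n : ℕ} {X : Finset (Fin n → ℤ)} {f : X → ℝ} {k a : ℝ}
    (ha : 0 ≤ a) (t : ℝ) (r p : EuclideanSpace ℝ (Fin n)) (hk : a * ‖p‖ ^ 2 < k)
    (hf : ∀ x : X, dentedQuadratic k a t r p (realPoint x.1) = f x) :
    IsConvexExtension X f (dentedQuadratic k a t r p) :=
  ⟨(strongConvexOn_dentedQuadratic (convex_realHull X) ha t r p).convexOn fun x => by
    have : 0 < k - a * ‖p‖ ^ 2 := by linarith
    simp only [Pi.zero_apply]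
    positivity, hf⟩

/-! ### Feasibility -/

theorem inner_realPoint {n : ℕ} (p : EuclideanSpace ℝ (Fin n)) (z : Fin n → ℤ) :
    inner ℝ p (realPoint z) = ∑ i, p i * z i := by
  simp [realPoint, PiLp.inner_apply, mul_comm]

theorem norm_realPoint_sq {n : ℕ} (z : Fin n → ℤ) : ‖realPoint z‖ ^ 2 = ∑ i, (z i : ℝ) ^ 2 := by
  simp [realPoint, EuclideanSpace.norm_sq_eq]

/-- The convex envelope is infinite at points that are strictly separated from the domain. -/
theorem convexEnvelope_eq_top {n : ℕ} {X : Finset (Fin n → ℤ)} (f : X → ℝ)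
    {x p : EuclideanSpace ℝ (Fin n)} {b : ℝ} (hX : ∀ y : X, inner ℝ p (realPoint y.1) ≤ b)
    (hx : b < inner ℝ p x) : convexEnvelope X f x = ⊤ := by
  obtain ⟨m, hm⟩ := (Set.finite_range f).bddBelow
  rw [EReal.eq_top_iff_forall_lt]
  intro s
  have hgap : 0 < inner ℝ p x - b := sub_pos.2 hx
  -- The affine function `c * (⟪p, ·⟫ - b) + m` is at most `m` on `X`, and this slope lifts it to `m
  -- + |s - m| + 1 > s` at `x`.
  set c : ℝ := (|s - m| + 1) / (inner ℝ p x - b) with hc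
  have hc0 : 0 ≤ c := by positivity
  refine lt_of_lt_of_le ?_
    (le_iSup_of_le (c • p) (le_iSup_of_le (m - c * b) (le_iSup_of_le (fun y => ?_) le_rfl)))
  · rw [EReal.coe_lt_coe_iff, real_inner_smul_left]
    have hmul : c * (inner ℝ p x - b) = |s - m| + 1 := div_mul_cancel₀ _ hgap.ne'
    nlinarith [le_abs_self (s - m)]
  · rw [real_inner_smul_left]
    have := mul_le_mul_of_nonneg_left (hX y) hc0
    have := hm (Set.mem_range_self y)
    linarith

/-- Both minima are over a finite nonempty set of feasible actions; infeasible ones cost `⊤` and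
cannot compete. -/
theorem DPCosts.feasible_of_convexEnvelope_eq_top {d c : ℕ} {S : DPSystem d c} (C : DPCosts S)
    (hne : ∀ x : S.states, ∃ u : S.actions, S.next x.1 u.1 ∈ S.states)
    (htop : ∀ (J : S.states → ℝ) (z : Fin d → ℤ), z ∉ S.states →
      convexEnvelope S.states J (realPoint z) = ⊤) : C.Feasible where
  original J x := by
    have : Nonempty {u : S.actions // S.next x.1 u.1 ∈ S.states} := nonempty_subtype.2 (hne x)
    obtain ⟨u, hu⟩ := Finite.exists_min
      fun u : {u : S.actions // S.next x.1 u.1 ∈ S.states} => C.gu u.1 + J ⟨_, u.2⟩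
    exact ⟨u.1, u.2, fun v hv => hu ⟨v, hv⟩⟩
  conjugate J x := by
    have : Nonempty {u : S.actions // S.next x.1 u.1 ∈ S.states} := nonempty_subtype.2 (hne x)
    obtain ⟨u, hu⟩ := Finite.exists_min
      fun u : {u : S.actions // S.next x.1 u.1 ∈ S.states} =>
        (C.gu u.1 : EReal) + convexEnvelope S.states J (realPoint (S.next x.1 u.1.1))
    refine ⟨u.1, u.2, fun v => ?_⟩
    by_cases hv : S.next x.1 v.1 ∈ S.states
    · exact hu ⟨v, hv⟩
    · rw [htop J _ hv, EReal.coe_add_top]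
      exact le_top

/-! ### Unstructured search on the hypercube -/

/-- Movement on the hypercube by integer steps: each coordinate of the state is
changed by `-1`, `0` or `1`. -/
def hypercubeSystem (d : ℕ) : DPSystem d d where
  states := Fintype.piFinset fun _ => {0, 1}
  actions := Fintype.piFinset fun _ => {-1, 0, 1}
  A := 1
  B := 1
  horizon := 1

/-- The costs `‖x‖²` of states and `‖u‖²` of actions, with a given terminal cost. -/
def hypercubeCosts {d : ℕ} (gT : (hypercubeSystem d).states → ℝ) :
    DPCosts (hypercubeSystem d) where
  gx x := ∑ i, (x.1 i : ℝ) ^ 2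
  gu u := ∑ i, (u.1 i : ℝ) ^ 2
  gT := gT

section Hypercube

variable {d : ℕ}

theorem hypercubeSystem_next (x u : Fin d → ℤ) : (hypercubeSystem d).next x u = x + u := by
  simp [hypercubeSystem, DPSystem.next]

theorem mem_hypercubeSystem_states {z : Fin d → ℤ} :
    z ∈ (hypercubeSystem d).states ↔ ∀ i, z i = 0 ∨ z i = 1 := by
  simp [hypercubeSystem]

theorem mem_hypercubeSystem_actions {u : Fin d → ℤ} :
    u ∈ (hypercubeSystem d).actions ↔ ∀ i, u i = -1 ∨ u i = 0 ∨ u i = 1 := by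
  simp [hypercubeSystem]

theorem card_hypercubeSystem_states : Fintype.card (hypercubeSystem d).states = 2 ^ d := by
  rw [Fintype.card_coe]
  simp [hypercubeSystem, Fintype.card_piFinset]

instance : Nonempty (hypercubeSystem d).states :=
  ⟨⟨0, mem_hypercubeSystem_states.2 fun _ => Or.inl rfl⟩⟩

theorem sub_mem_hypercubeSystem_actions {x y : Fin d → ℤ} (hx : x ∈ (hypercubeSystem d).states)
    (hy : y ∈ (hypercubeSystem d).states) : y - x ∈ (hypercubeSystem d).actions := by
  rw [mem_hypercubeSystem_states] at hx hy
  rw [mem_hypercubeSystem_actions]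
  intro i
  rw [Pi.sub_apply]
  rcases hx i with h | h <;> rcases hy i with h' | h' <;> simp [h, h']

theorem convexEnvelope_hypercube_eq_top (J : (hypercubeSystem d).states → ℝ) {z : Fin d → ℤ}
    (hz : z ∉ (hypercubeSystem d).states) :
    convexEnvelope (hypercubeSystem d).states J (realPoint z) = ⊤ := by
  obtain ⟨i, hi⟩ : ∃ i, ¬(z i = 0 ∨ z i = 1) := by
    simpa [mem_hypercubeSystem_states] using hz
  have hinner : ∀ (a : ℝ) (y : Fin d → ℤ),
      inner ℝ (EuclideanSpace.single i a) (realPoint y) = a * y i := fun a y => by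
    rw [EuclideanSpace.inner_single_left]
    rfl
  have hcube : ∀ y : (hypercubeSystem d).states, 0 ≤ (y.1 i : ℝ) ∧ (y.1 i : ℝ) ≤ 1 := fun y => by
    rcases mem_hypercubeSystem_states.1 y.2 i with h | h <;> simp [h]
  -- By integrality the bad coordinate is negative or at least 2, so a coordinate hyperplane
  -- separates strictly.
  rcases lt_or_ge (z i) 0 with hneg | hpos
  · refine convexEnvelope_eq_top J (p := EuclideanSpace.single i (-1)) (b := 0) (fun y => ?_) ?_
    · rw [hinner]
      linarith [hcube y]
    · rw [hinner]
      have : (z i : ℝ) < 0 := by exact_mod_cast hneg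
      linarith
  · refine convexEnvelope_eq_top J (p := EuclideanSpace.single i 1) (b := 1) (fun y => ?_) ?_
    · rw [hinner]
      linarith [hcube y]
    · rw [hinner, one_mul]
      have : 1 < z i := by omega
      exact_mod_cast this

theorem hypercubeCosts_feasible (gT : (hypercubeSystem d).states → ℝ) :
    (hypercubeCosts gT).Feasible :=
  DPCosts.feasible_of_convexEnvelope_eq_top _
    (fun x => ⟨⟨0, mem_hypercubeSystem_actions.2 fun _ => Or.inr (Or.inl rfl)⟩, by
      rw [hypercubeSystem_next, add_zero]
      exact x.2⟩)
    fun J _ hz => convexEnvelope_hypercube_eq_top J hz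

/-- Pulling down one vertex of the hypercube leaves a function with a smooth strongly convex
extension. -/
theorem exists_dentedQuadratic_eq_single (w : (hypercubeSystem d).states) (a : ℝ) :
    ∃ (k t : ℝ) (r p : EuclideanSpace ℝ (Fin d)), a * ‖p‖ ^ 2 < k ∧
      ∀ z : (hypercubeSystem d).states,
        dentedQuadratic k a t r p (realPoint z.1) =
          (Pi.single w (-a) : (hypercubeSystem d).states → ℝ) z := by
  have hsq : ∀ (z : (hypercubeSystem d).states) (i : Fin d), (z.1 i : ℝ) ^ 2 = z.1 i :=
    fun z i => by rcases mem_hypercubeSystem_states.1 z.2 i with h | h <;> simp [h]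
  obtain ⟨k, hk⟩ := exists_gt (a * ‖realPoint fun i => 1 - 2 * w.1 i‖ ^ 2)
  -- On vertices `t - ⟪p, z⟫` is 1 minus the Hamming distance from `w` to `z`, so its positive part
  -- is 1 at `w` and 0 elsewhere. The choice of `r` cancels `k * ‖z‖ ^ 2`, since `z i ^ 2 = z i`;
  -- hence `k` can be as large as needed.
  refine ⟨k, 1 - ∑ i, (w.1 i : ℝ), WithLp.toLp 2 fun _ => -k,
    realPoint fun i => 1 - 2 * w.1 i, hk, fun z => ?_⟩
  have hdist : 1 - ∑ i, (w.1 i : ℝ) - inner ℝ (realPoint fun i => 1 - 2 * w.1 i) (realPoint z.1) =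
      1 - ∑ i, ((w.1 i : ℝ) - z.1 i) ^ 2 := by
    rw [inner_realPoint, sub_sub, ← Finset.sum_add_distrib]
    refine congrArg _ (Finset.sum_congr rfl fun i _ => ?_)
    simp only [realPoint]
    push_cast
    linear_combination -hsq w i - hsq z i
  have hquad : k * ‖realPoint z.1‖ ^ 2 +
      inner ℝ (WithLp.toLp 2 fun _ => -k : EuclideanSpace ℝ (Fin d)) (realPoint z.1) = 0 := by
    rw [inner_realPoint, norm_realPoint_sq, Finset.mul_sum, ← Finset.sum_add_distrib]
    refine Finset.sum_eq_zero fun i _ => ?_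
    rw [hsq z i]
    ring
  rw [dentedQuadratic, hquad, hdist, zero_sub]
  by_cases hzw : z = w
  · simp [hzw]
  · obtain ⟨i, hi⟩ : ∃ i, w.1 i ≠ z.1 i := by
      by_contra! h
      exact hzw (Subtype.ext (funext h)).symm
    have hi1 : (1 : ℝ) ≤ ((w.1 i : ℝ) - z.1 i) ^ 2 := by
      have : 0 < (w.1 i - z.1 i) ^ 2 := by
        have := sub_ne_zero.2 hi
        positivity
      exact_mod_cast this
    have hsum : (1 : ℝ) ≤ ∑ i, ((w.1 i : ℝ) - z.1 i) ^ 2 :=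
      hi1.trans (Finset.single_le_sum (f := fun i => ((w.1 i : ℝ) - z.1 i) ^ 2)
        (fun _ _ => sq_nonneg _) (Finset.mem_univ i))
    rw [max_eq_left (by linarith), Pi.single_eq_of_ne hzw]
    simp

theorem dentedQuadratic_norm_sq {n : ℕ} (z : Fin n → ℤ) :
    dentedQuadratic 1 0 0 0 0 (realPoint z) = ∑ i, (z i : ℝ) ^ 2 := by
  simp [dentedQuadratic, norm_realPoint_sq]

theorem hypercubeCosts_modelling (w : (hypercubeSystem d).states) {a : ℝ} (ha : 0 ≤ a) :
    (hypercubeCosts (Pi.single w (-a))).Modelling where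
  terminal := by
    obtain ⟨k, t, r, p, hk, h⟩ := exists_dentedQuadratic_eq_single w a
    exact ⟨_, isConvexExtension_dentedQuadratic ha t r p hk h,
      exists_lipschitzOnWith_dentedQuadratic (convex_realHull _) (isBounded_realHull _) _ _ _ _ _,
      hasFiniteConditionNumber_dentedQuadratic (convex_realHull _) ha t r p hk⟩
  state := ⟨_, isConvexExtension_dentedQuadratic le_rfl 0 0 0 (by simp)
      fun x => dentedQuadratic_norm_sq x.1,
    exists_lipschitzOnWith_dentedQuadratic (convex_realHull _) (isBounded_realHull _) _ _ _ _ _,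
    hasFiniteConditionNumber_dentedQuadratic (convex_realHull _) le_rfl _ _ _ (by simp)⟩
  action := ⟨_, isConvexExtension_dentedQuadratic le_rfl 0 0 0 (by simp)
      fun x => dentedQuadratic_norm_sq x.1,
    hasFiniteConditionNumber_dentedQuadratic (convex_realHull _) le_rfl _ _ _ (by simp)⟩

theorem hypercubeCosts_valueFunction_zero (x : (hypercubeSystem d).states) :
    (hypercubeCosts 0).valueFunction x = (hypercubeCosts (d := d) 0).gx x := by
  refine IsLeast.csInf_eq ⟨⟨⟨0, mem_hypercubeSystem_actions.2 fun _ => Or.inr (Or.inl rfl)⟩, ?_, ?_⟩,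
    ?_⟩
  · rw [hypercubeSystem_next, add_zero]
    exact x.2
  · simp [hypercubeCosts]
  · rintro _ ⟨u, _, rfl⟩
    have : 0 ≤ (hypercubeCosts (d := d) 0).gu u := by
      simp only [hypercubeCosts]
      positivity
    simpa [hypercubeCosts] using this

/-- Jumping straight to `w` costs at most `d` and gains `d + 1`; the extra 1 makes the inequality
strict. -/
theorem hypercubeCosts_valueFunction_single_lt (w x : (hypercubeSystem d).states) :
    (hypercubeCosts (Pi.single w (-((d : ℝ) + 1)))).valueFunction x <
      (hypercubeCosts (d := d) 0).gx x := by
  set C : DPCosts (hypercubeSystem d) := hypercubeCosts (Pi.single w (-((d : ℝ) + 1)))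
  have hfin : Set.Finite {r : ℝ | ∃ (u : (hypercubeSystem d).actions)
      (h : (hypercubeSystem d).next x.1 u.1 ∈ (hypercubeSystem d).states),
      r = C.gx x + C.gu u + C.gT ⟨(hypercubeSystem d).next x.1 u.1, h⟩} := by
    refine (Set.finite_range fun u : {u : (hypercubeSystem d).actions //
      (hypercubeSystem d).next x.1 u.1 ∈ (hypercubeSystem d).states} =>
        C.gx x + C.gu u.1 + C.gT ⟨_, u.2⟩).subset ?_
    rintro _ ⟨u, h, rfl⟩
    exact ⟨⟨u, h⟩, rfl⟩
  have hnext : (hypercubeSystem d).next x.1 (w.1 - x.1) = w.1 := by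
    rw [hypercubeSystem_next, add_sub_cancel]
  have hmem : (hypercubeSystem d).next x.1 (w.1 - x.1) ∈ (hypercubeSystem d).states := by
    rw [hnext]
    exact w.2
  have hact := sub_mem_hypercubeSystem_actions x.2 w.2
  refine (csInf_le hfin.bddBelow ⟨⟨_, hact⟩, hmem, rfl⟩).trans_lt ?_
  have hgT : C.gT ⟨(hypercubeSystem d).next x.1 (w.1 - x.1), hmem⟩ = -((d : ℝ) + 1) := by
    simp [C, hypercubeCosts, hnext]
  have hgu : C.gu ⟨_, hact⟩ ≤ d := by
    calc ∑ i, ((w.1 - x.1) i : ℝ) ^ 2 ≤ ∑ _i : Fin d, (1 : ℝ) := by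
          refine Finset.sum_le_sum fun i _ => ?_
          rcases mem_hypercubeSystem_actions.1 hact i with h | h | h <;> simp [h]
      _ = d := by simp
  have hgx : C.gx x = (hypercubeCosts (d := d) 0).gx x := rfl
  rw [hgT, hgx]
  linarith

theorem hypercubeCosts_eval_eq_of_ne (w : (hypercubeSystem d).states) (a : ℝ)
    (q : DPCosts.Query (hypercubeSystem d)) (hq : q ≠ Sum.inr (Sum.inr w)) :
    (hypercubeCosts 0).eval q = (hypercubeCosts (Pi.single w a)).eval q := by
  rcases q with x | u | z
  · rfl
  · rfl
  · have hzw : z ≠ w := fun h => hq (by rw [h])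
    simp [DPCosts.eval, hypercubeCosts, hzw]

end Hypercube

theorem mainTheorem5 :
    ∃ κ : ℝ, 0 < κ ∧ ∀ d : ℕ, 1 ≤ d →
      ∃ (c : ℕ) (S : DPSystem d c) (F : Set (DPCosts S)),
        F.Finite ∧
        S.horizon = 1 ∧
        S.states = Fintype.piFinset (fun _ : Fin d => ({0, 1} : Finset ℤ)) ∧
        (∀ C ∈ F, C.Modelling ∧ C.Feasible) ∧
        ∀ (x : S.states) (M : QuantumAlgorithm (DPCosts.Query S)),
          (∀ C ∈ F, 2 / 3 ≤ M.outputProb C.eval (C.valueFunction x)) →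
            κ * (Real.sqrt (2 ^ d) / d) ≤ (M.numQueries : ℝ) := by
  refine ⟨1 / 10, by norm_num, fun d hd => ⟨d, hypercubeSystem d,
    insert (hypercubeCosts 0)
      (Set.range fun w => hypercubeCosts (Pi.single w (-((d : ℝ) + 1)))),
    (Set.finite_range _).insert _, rfl, rfl, ?_, fun x M hM => ?_⟩⟩
  · rintro _ (rfl | ⟨w, rfl⟩)
    · refine ⟨?_, hypercubeCosts_feasible _⟩
      -- The zero terminal cost is a dent of depth 0 at an arbitrary vertex.
      simpa using hypercubeCosts_modelling (Classical.arbitrary (hypercubeSystem d).states) le_rfl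
    · exact ⟨hypercubeCosts_modelling w (by positivity), hypercubeCosts_feasible _⟩
  · have h0 := hM _ (Set.mem_insert _ _)
    rw [hypercubeCosts_valueFunction_zero] at h0
    have hbound := M.sqrt_card_le_numQueries
      (q := fun w : (hypercubeSystem d).states => Sum.inr (Sum.inr w))
      (Sum.inr_injective.comp Sum.inr_injective)
      (fun w => hypercubeCosts_eval_eq_of_ne w _)
      (fun w => (hypercubeCosts_valueFunction_single_lt w x).ne') h0
      (fun w => hM _ (Set.mem_insert_of_mem _ ⟨w, rfl⟩))
    rw [card_hypercubeSystem_states, Nat.cast_pow, Nat.cast_ofNat] at hbound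
    refine le_trans ?_ hbound
    gcongr
    -- The search bound holds without the factor `1 / d`, which is given away here.
    exact div_le_self (Real.sqrt_nonneg _) (by exact_mod_cast hd)
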